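/- **Theorem 6.1.** Let $b,k>0$ and let $\varphi(x)=\frac b2x^2+kx$ for $x\ge 0$, $\varphi(x)=-\frac b2x^2+kx$ for $x<0$. Let $0<g<1$, $0<m_T<m_0$ and $m_0-m_T<T$, and consider the optimal control problem $$\dot s=x,\quad \dot x=u-\varphi(x)-g,\quad \dot m=-u,\quad 0\le u\le 1\quad (0\le t\le T),$$ $$s(0)=0,\quad x(0)=0,\quad m(0)=m_0,\quad m(T)\ge m_T,\qquad s(T)\to\max .$$ An admissible process $(s,x,m,u)$ (with $u$ measurable and $s,x,m$ absolutely continuous) *satisfies the maximum principle* if there are constants $\alpha_0,\alpha,\beta_s,\beta_x,\beta_m$, not all zero, and Lipschitz functions $\psi_s,\psi_x,\psi_m$ on $[0,T]$ such that, with $H=\psi_s x+\psi_x(u-\varphi(x)-g)-\psi_m u$: $\alpha_0\ge 0$ and $\alpha\ge 0$; $\ \alpha\,(m(T)-m_T)=0$; $\ \dot\psi_s=0$, $\dot\psi_x=-\psi_s+\psi_x\varphi'(x)$, $\dot\psi_m=0$ almost everywhere; $\ \psi_s(0)=\beta_s$, $\psi_x(0)=\beta_x$, $\psi_m(0)=\beta_m$,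 $\psi_s(T)=\alpha_0$, $\psi_x(T)=0$, $\psi_m(T)=\alpha$; $\ H$ is (a.e.) constant along the process; and for almost every $t$ the control value $u(t)$ maximizes $H$ over $[0,1]$. Say that an admissible process is of type Ia, Ib, IIa, IIb, III if $[0,T]$ is divided into consecutive intervals of positive length, on which $u$ equals almost everywhere, respectively, $(1,0)$; $(1,u_{sing},0)$; $(0,1,0)$; $(0,1,u_{sing},0)$; $(1,0,1,0)$, where $u_{sing}(t)=\varphi(x(t))+g$. Then: 1. no admissible process of type III satisfies the maximum principle; 2. every admissible process that satisfies the maximum principle is of type Ia, Ib, IIa or IIb. -/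

import Mathlib

open Set MeasureTheory

/-- The quadratic resistance function: `(b/2) x² + k x` for `x ≥ 0`, `-(b/2) x² + k x` for `x < 0`. -/
noncomputable def quadResistance (b k : ℝ) (x : ℝ) : ℝ :=
  if 0 ≤ x then b / 2 * x ^ 2 + k * x else -(b / 2) * x ^ 2 + k * x

/-- The data of the rocket problem: resistance function, gravity, flight time, initial mass and
mass of the empty vehicle. -/
structure RocketProblem where
  φ : ℝ → ℝ
  g : ℝ
  T : ℝ
  m₀ : ℝ
  mT : ℝ

/-- A process: position, velocity, mass and control as functions of time.  Only the values on
`[0, T]` matter. -/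
structure RocketProcess where
  s : ℝ → ℝ
  x : ℝ → ℝ
  m : ℝ → ℝ
  u : ℝ → ℝ

namespace RocketProblem

/-- Admissible processes of the problem: `u` is a measurable control with values in `[0, 1]`,
the state is absolutely continuous on `[0, T]`, the state equations
`ṡ = x`, `ẋ = u - φ(x) - g`, `ṁ = -u` hold almost everywhere on `[0, T]`, and the endpoint
constraints `s(0) = 0`, `x(0) = 0`, `m(0) = m₀`, `m(T) ≥ mT` hold. -/
structure IsAdmissible (P : RocketProblem) (w : RocketProcess) : Prop where
  u_measurable : AEMeasurable w.u (volume.restrict (Icc 0 P.T))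
  u_mem : ∀ᵐ t ∂volume.restrict (Icc 0 P.T), w.u t ∈ Icc (0 : ℝ) 1
  s_ac : AbsolutelyContinuousOnInterval w.s 0 P.T
  x_ac : AbsolutelyContinuousOnInterval w.x 0 P.T
  m_ac : AbsolutelyContinuousOnInterval w.m 0 P.T
  s_deriv : ∀ᵐ t ∂volume.restrict (Icc 0 P.T), HasDerivAt w.s (w.x t) t
  x_deriv : ∀ᵐ t ∂volume.restrict (Icc 0 P.T),
    HasDerivAt w.x (w.u t - P.φ (w.x t) - P.g) t
  m_deriv : ∀ᵐ t ∂volume.restrict (Icc 0 P.T), HasDerivAt w.m (-w.u t) t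
  s_init : w.s 0 = 0
  x_init : w.x 0 = 0
  m_init : w.m 0 = P.m₀
  m_final : P.mT ≤ w.m P.T

/-- The Pontryagin function `H = ψ_s x + ψ_x (u - φ(x) - g) - ψ_m u`. -/
def pontryaginFunction (P : RocketProblem) (ψs ψx ψm x u : ℝ) : ℝ :=
  ψs * x + ψx * (u - P.φ x - P.g) - ψm * u

/-- The process `w` satisfies the Pontryagin maximum principle with the multipliers
`(α₀, α, β_s, β_x, β_m)` and the costates `ψ_s, ψ_x, ψ_m`. -/
structure IsMultiplier (P : RocketProblem) (w : RocketProcess)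
    (α₀ α βs βx βm : ℝ) (ψs ψx ψm : ℝ → ℝ) : Prop where
  ψs_lipschitz : ∃ K, LipschitzOnWith K ψs (Icc 0 P.T)
  ψx_lipschitz : ∃ K, LipschitzOnWith K ψx (Icc 0 P.T)
  ψm_lipschitz : ∃ K, LipschitzOnWith K ψm (Icc 0 P.T)
  nonneg : 0 ≤ α₀ ∧ 0 ≤ α
  nontrivial : (α₀, α, βs, βx, βm) ≠ (0, 0, 0, 0, 0)
  slackness : α * (w.m P.T - P.mT) = 0
  adjoint_s : ∀ᵐ t ∂volume.restrict (Icc 0 P.T), HasDerivAt ψs 0 t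
  adjoint_x : ∀ᵐ t ∂volume.restrict (Icc 0 P.T),
    HasDerivAt ψx (-(ψs t - ψx t * deriv P.φ (w.x t))) t
  adjoint_m : ∀ᵐ t ∂volume.restrict (Icc 0 P.T), HasDerivAt ψm 0 t
  transversality_s : ψs 0 = βs ∧ ψs P.T = α₀
  transversality_x : ψx 0 = βx ∧ ψx P.T = 0
  transversality_m : ψm 0 = βm ∧ ψm P.T = α
  energy : ∃ C : ℝ, ∀ᵐ t ∂volume.restrict (Icc 0 P.T),
    P.pontryaginFunction (ψs t) (ψx t) (ψm t) (w.x t) (w.u t) = C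
  maximality : ∀ᵐ t ∂volume.restrict (Icc 0 P.T), ∀ v ∈ Icc (0 : ℝ) 1,
    P.pontryaginFunction (ψs t) (ψx t) (ψm t) (w.x t) v ≤
      P.pontryaginFunction (ψs t) (ψx t) (ψm t) (w.x t) (w.u t)

/-- The process `w` satisfies the Pontryagin maximum principle. -/
def SatisfiesMP (P : RocketProblem) (w : RocketProcess) : Prop :=
  ∃ (α₀ α βs βx βm : ℝ) (ψs ψx ψm : ℝ → ℝ), P.IsMultiplier w α₀ α βs βx βm ψs ψx ψm

/-- The control equals the function `v` (almost everywhere) on the open interval `]a, c[`. -/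
def ControlOn (w : RocketProcess) (a c : ℝ) (v : ℝ → ℝ) : Prop :=
  ∀ᵐ t ∂volume.restrict (Ioo a c), w.u t = v t

/-- The singular control `u_sing = φ(x) + g`, i.e. the one that keeps the velocity constant. -/
def uSing (P : RocketProblem) (w : RocketProcess) (t : ℝ) : ℝ := P.φ (w.x t) + P.g

/-- Type Ia: `u = (1, 0)` on `]0, t₁[, ]t₁, T[`. -/
def IsTypeIa (P : RocketProblem) (w : RocketProcess) : Prop :=
  ∃ t₁, 0 < t₁ ∧ t₁ < P.T ∧
    ControlOn w 0 t₁ (fun _ => 1) ∧ ControlOn w t₁ P.T (fun _ => 0)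

/-- Type Ib: `u = (1, u_sing, 0)` on `]0, t₁[, ]t₁, t₂[, ]t₂, T[`. -/
def IsTypeIb (P : RocketProblem) (w : RocketProcess) : Prop :=
  ∃ t₁ t₂, 0 < t₁ ∧ t₁ < t₂ ∧ t₂ < P.T ∧
    ControlOn w 0 t₁ (fun _ => 1) ∧ ControlOn w t₁ t₂ (P.uSing w) ∧
    ControlOn w t₂ P.T (fun _ => 0)

/-- Type IIa: `u = (0, 1, 0)` on `]0, t₁[, ]t₁, t₂[, ]t₂, T[`. -/
def IsTypeIIa (P : RocketProblem) (w : RocketProcess) : Prop :=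
  ∃ t₁ t₂, 0 < t₁ ∧ t₁ < t₂ ∧ t₂ < P.T ∧
    ControlOn w 0 t₁ (fun _ => 0) ∧ ControlOn w t₁ t₂ (fun _ => 1) ∧
    ControlOn w t₂ P.T (fun _ => 0)

/-- Type IIb: `u = (0, 1, u_sing, 0)` on `]0, t₁[, ]t₁, t₂[, ]t₂, t₃[, ]t₃, T[`. -/
def IsTypeIIb (P : RocketProblem) (w : RocketProcess) : Prop :=
  ∃ t₁ t₂ t₃, 0 < t₁ ∧ t₁ < t₂ ∧ t₂ < t₃ ∧ t₃ < P.T ∧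
    ControlOn w 0 t₁ (fun _ => 0) ∧ ControlOn w t₁ t₂ (fun _ => 1) ∧
    ControlOn w t₂ t₃ (P.uSing w) ∧ ControlOn w t₃ P.T (fun _ => 0)

/-- Type III: `u = (1, 0, 1, 0)` on `]0, t₁[, ]t₁, t₂[, ]t₂, t₃[, ]t₃, T[`. -/
def IsTypeIII (P : RocketProblem) (w : RocketProcess) : Prop :=
  ∃ t₁ t₂ t₃, 0 < t₁ ∧ t₁ < t₂ ∧ t₂ < t₃ ∧ t₃ < P.T ∧
    ControlOn w 0 t₁ (fun _ => 1) ∧ ControlOn w t₁ t₂ (fun _ => 0) ∧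
    ControlOn w t₂ t₃ (fun _ => 1) ∧ ControlOn w t₃ P.T (fun _ => 0)

end RocketProblem

/-! The costates `ψs` and `ψm` are the constants `α₀` and `α`, so maximality makes `u` bang-bang in
the sign of `ψ - α`, where `ψ = ψx`. Both multipliers are positive: if `α₀ = 0`, then `ψ = 0` and no
fuel is burnt, against slackness; if `α = 0`, the engine runs throughout and burns too much.

Put `F y = α₀ y - α (φ y + g)`. Constancy of `H` gives `F (x t) = α₀ x(T)` whenever `ψ t = α`. The
core is that all these times share one velocity (`switch_unique`). By `switch_nonneg` the velocity
there is nonnegative, by `slope_le` it lies where `F' ≥ 0`, and on that part of the half-line the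
strictly concave `F` is injective.

Since `0 < φ(x) + g < 1`, velocity strictly rises under full thrust and strictly falls without
thrust. Hence `ψ` cannot leave the level `α` and return (`no_gap`), and the times with `ψ = α` form
an interval, on which `x` is constant and `u` is singular. Before it `ψ > α`, since coasting from
rest would reach it with negative velocity; after it `ψ < α`, since `ψ(T) = 0`. So only types Ia and
Ib actually occur. -/

/-! ### Absolutely continuous functions and linear differential inequalities. -/

/-- A property that holds almost everywhere holds somewhere in a nonempty open interval. -/
theorem exists_mem_Ioo_of_ae {p : ℝ → Prop} {a c : ℝ} (hac : a < c) (h : ∀ᵐ t, p t) :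
    ∃ t ∈ Ioo a c, p t := by
  by_contra! hne
  have h0 : volume (Ioo a c) = 0 := measure_mono_null (fun t ht => hne t ht) h
  simp [hac.not_ge] at h0

/-- An absolutely continuous function with nonnegative derivative does not decrease. -/
theorem AbsolutelyContinuousOnInterval.le_of_ae_deriv_nonneg {f : ℝ → ℝ} {a c : ℝ} (hac : a ≤ c)
    (hf : AbsolutelyContinuousOnInterval f a c)
    (hd : ∀ᵐ t, t ∈ Ioo a c → ∃ d, HasDerivAt f d t ∧ 0 ≤ d) : f a ≤ f c := by
  rw [← sub_nonneg, ← hf.integral_deriv_eq_sub]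
  refine intervalIntegral.integral_nonneg_of_ae_restrict hac ?_
  refine ae_restrict_of_ae_eq_of_ae_restrict Ioo_ae_eq_Icc ?_
  rw [ae_restrict_iff' measurableSet_Ioo]
  filter_upwards [hd] with t ht h
  obtain ⟨d, h1, h2⟩ := ht h
  simpa [h1.deriv] using h2

/-- An absolutely continuous function with positive derivative increases. -/
theorem AbsolutelyContinuousOnInterval.lt_of_ae_deriv_pos {f : ℝ → ℝ} {a c : ℝ} (hac : a < c)
    (hf : AbsolutelyContinuousOnInterval f a c)
    (hd : ∀ᵐ t, t ∈ Ioo a c → ∃ d, HasDerivAt f d t ∧ 0 < d) : f a < f c := by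
  have hpos : ∀ᵐ t ∂volume.restrict (Ioc a c), 0 < deriv f t := by
    refine ae_restrict_of_ae_eq_of_ae_restrict Ioo_ae_eq_Ioc ?_
    rw [ae_restrict_iff' measurableSet_Ioo]
    filter_upwards [hd] with t ht h
    obtain ⟨d, h1, h2⟩ := ht h
    simpa [h1.deriv] using h2
  have hnn : 0 ≤ᵐ[volume.restrict (Ioc a c)] deriv f := hpos.mono fun t ht => ht.le
  rw [← sub_pos, ← hf.integral_deriv_eq_sub, intervalIntegral.integral_of_le hac.le]
  refine lt_of_le_of_ne (integral_nonneg_of_ae hnn) fun h0 => ?_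
  rw [eq_comm, integral_eq_zero_iff_of_nonneg_ae hnn hf.intervalIntegrable_deriv.1] at h0
  rw [Filter.EventuallyEq, ae_restrict_iff' measurableSet_Ioc] at h0
  rw [ae_restrict_iff' measurableSet_Ioc] at hpos
  obtain ⟨t, ht, h1, h2⟩ := exists_mem_Ioo_of_ae hac (hpos.and h0)
  exact (h1 (Ioo_subset_Ioc_self ht)).ne' (h2 (Ioo_subset_Ioc_self ht))

/-- An integrating factor for the linear equation `f' = p f + h`. -/
theorem exists_integrating_factor {a c : ℝ} {p : ℝ → ℝ} (hac : a ≤ c)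
    (hp : ContinuousOn p (Icc a c)) :
    ∃ ρ : ℝ → ℝ, AbsolutelyContinuousOnInterval ρ a c ∧ (∀ t, 0 < ρ t) ∧ ρ a = 1 ∧
      ∀ t ∈ Ioo a c, HasDerivAt ρ (-(p t * ρ t)) t := by
  -- Extending `p` constantly beyond `[a, c]` makes it continuous on the line, so the primitive is
  -- differentiable at the endpoints too.
  set q : ℝ → ℝ := IccExtend hac ((Icc a c).domRestrict p) with hq
  have hqc : Continuous q := hp.domRestrict.Icc_extend'
  have hI : ∀ t, HasDerivAt (fun t => ∫ s in a..t, q s) (q t) t := fun t =>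
    intervalIntegral.integral_hasDerivAt_right (hqc.intervalIntegrable _ _)
      (hqc.stronglyMeasurableAtFilter _ _) hqc.continuousAt
  have hρ : ∀ t, HasDerivAt (fun t => Real.exp (-∫ s in a..t, q s))
      (Real.exp (-∫ s in a..t, q s) * -q t) t := fun t => (hI t).fun_neg.exp
  refine ⟨fun t => Real.exp (-∫ s in a..t, q s), ?_, fun t => Real.exp_pos _, by simp, ?_⟩
  · refine ContDiffOn.absolutelyContinuousOnInterval (ContDiff.contDiffOn ?_)
    rw [contDiff_one_iff_deriv]
    refine ⟨fun t => (hρ t).differentiableAt, ?_⟩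
    have hIc : Continuous fun t => ∫ s in a..t, q s :=
      continuous_iff_continuousAt.2 fun t => (hI t).continuousAt
    rw [funext fun t => (hρ t).deriv]
    fun_prop
  · intro t ht
    have : q t = p t := by rw [hq, IccExtend_of_mem _ _ (Ioo_subset_Icc_self ht)]; rfl
    convert hρ t using 1
    rw [this]; ring

/-- The product of `f` with the integrating factor is nondecreasing. Only the sign of `E` is ever
used: the lemma and its strict version transport signs of `f` between the endpoints. -/
theorem AbsolutelyContinuousOnInterval.exists_le_mul_of_linear {f p : ℝ → ℝ} {a c : ℝ}
    (hac : a ≤ c) (hf : AbsolutelyContinuousOnInterval f a c) (hp : ContinuousOn p (Icc a c))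
    (hd : ∀ᵐ t, t ∈ Ioo a c → ∃ h, 0 ≤ h ∧ HasDerivAt f (p t * f t + h) t) :
    ∃ E, 0 < E ∧ f a ≤ E * f c := by
  obtain ⟨ρ, hρ, hpos, h1, hder⟩ := exists_integrating_factor hac hp
  refine ⟨ρ c, hpos c, ?_⟩
  have := (hρ.mul hf).le_of_ae_deriv_nonneg hac ?_
  · simpa [h1] using this
  · filter_upwards [hd] with t ht hm
    obtain ⟨h, h0, h2⟩ := ht hm
    refine ⟨_, (hder t hm).mul h2, ?_⟩
    have := mul_nonneg (hpos t).le h0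
    linarith

theorem AbsolutelyContinuousOnInterval.exists_lt_mul_of_linear {f p : ℝ → ℝ} {a c : ℝ}
    (hac : a < c) (hf : AbsolutelyContinuousOnInterval f a c) (hp : ContinuousOn p (Icc a c))
    (hd : ∀ᵐ t, t ∈ Ioo a c → ∃ h, 0 < h ∧ HasDerivAt f (p t * f t + h) t) :
    ∃ E, 0 < E ∧ f a < E * f c := by
  obtain ⟨ρ, hρ, hpos, h1, hder⟩ := exists_integrating_factor hac.le hp
  refine ⟨ρ c, hpos c, ?_⟩
  have := (hρ.mul hf).lt_of_ae_deriv_pos hac ?_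
  · simpa [h1] using this
  · filter_upwards [hd] with t ht hm
    obtain ⟨h, h0, h2⟩ := ht hm
    refine ⟨_, (hder t hm).mul h2, ?_⟩
    have := mul_pos (hpos t) h0
    linarith

theorem AbsolutelyContinuousOnInterval.subinterval {f : ℝ → ℝ} {a b c d : ℝ}
    (hf : AbsolutelyContinuousOnInterval f a b) (h1 : a ≤ c) (h2 : c ≤ d) (h3 : d ≤ b) :
    AbsolutelyContinuousOnInterval f c d :=
  hf.mono (by rw [uIcc_of_le h2, uIcc_of_le (h1.trans (h2.trans h3))]; exact Icc_subset_Icc h1 h3)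

theorem AbsolutelyContinuousOnInterval.sub_constant {f : ℝ → ℝ} {a b : ℝ}
    (hf : AbsolutelyContinuousOnInterval f a b) (v : ℝ) :
    AbsolutelyContinuousOnInterval (fun t => f t - v) a b :=
  hf.sub (LipschitzOnWith.absolutelyContinuousOnInterval (K := 0)
    ((LipschitzWith.const v).lipschitzOnWith))

/-! ### Topology of level sets. -/

/-- A continuous function that omits a value on a preconnected set stays on one side of it. -/
theorem IsPreconnected.forall_lt_or_forall_gt {f : ℝ → ℝ} {S : Set ℝ} {v : ℝ}
    (hS : IsPreconnected S) (hf : ContinuousOn f S) (hv : ∀ t ∈ S, f t ≠ v) :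
    (∀ t ∈ S, f t < v) ∨ ∀ t ∈ S, v < f t := by
  by_contra! h
  obtain ⟨⟨t, ht, h1⟩, r, hr, h2⟩ := h
  obtain ⟨q, hq, h3⟩ := hS.intermediate_value hr ht hf ⟨h2, h1⟩
  exact hv q hq h3

/-- The gap of a compact set around a point outside of it. -/
theorem IsCompact.exists_gap {Z : Set ℝ} (hZ : IsCompact Z) {p q t : ℝ} (hp : p ∈ Z) (hq : q ∈ Z)
    (hpt : p ≤ t) (htq : t ≤ q) (ht : t ∉ Z) :
    ∃ a ∈ Z, ∃ c ∈ Z, a < t ∧ t < c ∧ ∀ r ∈ Ioo a c, r ∉ Z := by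
  obtain ⟨a, ⟨haZ, hat⟩, ha⟩ :=
    (hZ.inter_right isClosed_Iic : IsCompact (Z ∩ Iic t)).exists_isGreatest ⟨p, hp, hpt⟩
  obtain ⟨c, ⟨hcZ, htc⟩, hc⟩ :=
    (hZ.inter_right isClosed_Ici : IsCompact (Z ∩ Ici t)).exists_isLeast ⟨q, hq, htq⟩
  refine ⟨a, haZ, c, hcZ, lt_of_le_of_ne hat ?_, lt_of_le_of_ne htc ?_, fun r hr hrZ => ?_⟩
  · rintro rfl; exact ht haZ
  · rintro rfl; exact ht hcZ
  · rcases le_total r t with h | h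
    · exact (ha ⟨hrZ, h⟩).not_gt hr.1
    · exact (hc ⟨hrZ, h⟩).not_gt hr.2

/-! ### The resistance function. -/

section Resistance

variable {b k : ℝ}

theorem quadResistance_eq (b k x : ℝ) : quadResistance b k x = b / 2 * (x * |x|) + k * x := by
  unfold quadResistance
  split_ifs with h
  · rw [abs_of_nonneg h]; ring
  · rw [abs_of_neg (not_le.1 h)]; ring

theorem hasDerivAt_mul_abs (x : ℝ) : HasDerivAt (fun y : ℝ => y * |y|) (2 * |x|) x := by
  rcases lt_trichotomy x 0 with h | rfl | h
  · refine ((hasDerivAt_id' x).fun_mul (hasDerivAt_abs_neg h)).congr_deriv ?_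
    rw [abs_of_neg h]; ring
  · rw [hasDerivAt_iff_tendsto_slope]
    have h0 : Filter.Tendsto (fun y : ℝ => |y|) (nhdsWithin 0 {0}ᶜ) (nhds (2 * |0|)) := by
      simpa using (continuous_abs.tendsto (0 : ℝ)).mono_left nhdsWithin_le_nhds
    refine h0.congr' ?_
    filter_upwards [self_mem_nhdsWithin] with y hy
    have hy : y ≠ 0 := hy
    simp [slope_def_field, hy]
  · refine ((hasDerivAt_id' x).fun_mul (hasDerivAt_abs_pos h)).congr_deriv ?_
    rw [abs_of_pos h]; ring

theorem hasDerivAt_quadResistance (b k x : ℝ) :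
    HasDerivAt (quadResistance b k) (b * |x| + k) x := by
  rw [funext (quadResistance_eq b k)]
  refine (((hasDerivAt_mul_abs x).const_mul (b / 2)).fun_add
    ((hasDerivAt_id' x).const_mul k)).congr_deriv ?_
  ring

theorem continuous_quadResistance (b k : ℝ) : Continuous (quadResistance b k) :=
  continuous_iff_continuousAt.2 fun x => (hasDerivAt_quadResistance b k x).continuousAt

theorem strictMono_quadResistance (hb : 0 < b) (hk : 0 < k) : StrictMono (quadResistance b k) :=
  strictMono_of_deriv_pos fun x => by
    rw [(hasDerivAt_quadResistance b k x).deriv]; positivity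

theorem exists_quadResistance_eq (hb : 0 < b) (hk : 0 < k) (y : ℝ) :
    ∃ v, quadResistance b k v = y := by
  -- The surplus at `y / k` has the sign of `y`, so `y` lies between the values at `0` and at `y /
  -- k`.
  have key : quadResistance b k (y / k) - y = b / 2 * (y / k * |y / k|) := by
    rw [quadResistance_eq]; field_simp; ring
  have h0 : quadResistance b k 0 = 0 := by simp [quadResistance]
  have hc := (continuous_quadResistance b k).continuousOn (s := univ)
  rcases le_total 0 y with h | h
  · have : 0 ≤ y / k := by positivity
    have h1 : 0 ≤ quadResistance b k (y / k) - y := by rw [key]; positivity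
    obtain ⟨v, -, hv⟩ := isPreconnected_univ.intermediate_value (mem_univ 0) (mem_univ (y / k)) hc
      ⟨h0.trans_le h, sub_nonneg.1 h1⟩
    exact ⟨v, hv⟩
  · have : y / k ≤ 0 := div_nonpos_of_nonpos_of_nonneg h hk.le
    have h1 : quadResistance b k (y / k) - y ≤ 0 := by
      rw [key]
      exact mul_nonpos_of_nonneg_of_nonpos (by positivity)
        (mul_nonpos_of_nonpos_of_nonneg this (abs_nonneg _))
    obtain ⟨v, -, hv⟩ := isPreconnected_univ.intermediate_value (mem_univ (y / k)) (mem_univ 0) hc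
      ⟨sub_nonpos.1 h1, h.trans_eq h0.symm⟩
    exact ⟨v, hv⟩

end Resistance

/-! ### Extremals and velocity bounds. -/

/-- A nontrivial extremal of the rocket problem with positive multipliers `α₀`, `α`: velocity `x`,
costate `ψ` and control `u`, together with the pointwise consequences of the maximum principle. -/
structure IsRocketExtremal (b k g T α₀ α : ℝ) (x ψ u : ℝ → ℝ) : Prop where
  b_pos : 0 < b
  k_pos : 0 < k
  g_pos : 0 < g
  g_lt_one : g < 1
  T_pos : 0 < T
  α₀_pos : 0 < α₀
  α_pos : 0 < α
  x_ac : AbsolutelyContinuousOnInterval x 0 T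
  ψ_ac : AbsolutelyContinuousOnInterval ψ 0 T
  x_init : x 0 = 0
  ψ_final : ψ T = 0
  u_mem : ∀ᵐ t, t ∈ Ioo 0 T → u t ∈ Icc (0 : ℝ) 1
  x_deriv : ∀ᵐ t, t ∈ Ioo 0 T → HasDerivAt x (u t - quadResistance b k (x t) - g) t
  ψ_deriv : ∀ᵐ t, t ∈ Ioo 0 T → HasDerivAt ψ (-(α₀ - ψ t * (b * |x t| + k))) t
  u_eq_one : ∀ᵐ t, t ∈ Ioo 0 T → α < ψ t → u t = 1
  u_eq_zero : ∀ᵐ t, t ∈ Ioo 0 T → ψ t < α → u t = 0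
  energy : ∃ C, ∀ t ∈ Icc 0 T,
    α₀ * x t - ψ t * (quadResistance b k (x t) + g) + max (ψ t - α) 0 = C
  u_ne_zero : ¬ ∀ᵐ t, t ∈ Ioo 0 T → u t = 0

/-- The velocity of a process of the rocket problem stays strictly between the terminal velocities
without thrust and with full thrust. -/
theorem quadResistance_add_mem_Ioo {b k g T : ℝ} {x u : ℝ → ℝ} (hb : 0 < b) (hk : 0 < k)
    (hg₀ : 0 < g) (hg₁ : g < 1) (x_ac : AbsolutelyContinuousOnInterval x 0 T) (x_init : x 0 = 0)
    (u_mem : ∀ᵐ t, t ∈ Ioo 0 T → u t ∈ Icc (0 : ℝ) 1)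
    (x_deriv : ∀ᵐ t, t ∈ Ioo 0 T → HasDerivAt x (u t - quadResistance b k (x t) - g) t)
    {t : ℝ} (ht : t ∈ Icc 0 T) : quadResistance b k (x t) + g ∈ Ioo (0 : ℝ) 1 := by
  have hac := x_ac.subinterval le_rfl ht.1 ht.2
  have hmono := strictMono_quadResistance hb hk
  have h00 : quadResistance b k 0 = 0 := by simp [quadResistance]
  have hxc : ContinuousOn x (Icc 0 t) := by
    have := hac.continuousOn; rwa [uIcc_of_le ht.1] at this
  have hsub : ∀ s ∈ Ioo 0 t, s ∈ Ioo 0 T := fun s hs => ⟨hs.1, hs.2.trans_le ht.2⟩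
  -- The divided difference of `φ` at a terminal velocity `v` turns the equation for `x - v` into a
  -- linear one with continuous coefficient and source `u` or `u - 1`.
  have hds : ∀ v, Continuous (dslope (quadResistance b k) v) := fun v => by
    rw [← continuousOn_univ, continuousOn_dslope Filter.univ_mem]
    exact ⟨(continuous_quadResistance b k).continuousOn,
      (hasDerivAt_quadResistance b k v).differentiableAt⟩
  have hsl : ∀ v y, dslope (quadResistance b k) v y * (y - v) =
      quadResistance b k y - quadResistance b k v := fun v y => by
    rw [mul_comm]; exact sub_smul_dslope _ v y
  constructor
  · obtain ⟨v, hv⟩ := exists_quadResistance_eq hb hk (-g)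
    have hv0 : v < 0 := hmono.lt_iff_lt.1 (by rw [hv, h00]; linarith)
    obtain ⟨E, hE, h⟩ := (hac.sub_constant v).exists_le_mul_of_linear
      (p := fun s => -dslope (quadResistance b k) v (x s)) ht.1
      ((hds v).comp_continuousOn hxc).neg (by
        filter_upwards [u_mem, x_deriv] with s h1 h2 hs
        refine ⟨u s, (h1 (hsub s hs)).1, ((h2 (hsub s hs)).sub_const v).congr_deriv ?_⟩
        have := hsl v (x s)
        linarith)
    rw [x_init] at h
    have : 0 < x t - v := pos_of_mul_pos_right (by linarith) hE.le
    have := hmono (sub_pos.1 this)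
    linarith
  · obtain ⟨v, hv⟩ := exists_quadResistance_eq hb hk (1 - g)
    have hv0 : 0 < v := hmono.lt_iff_lt.1 (by rw [hv, h00]; linarith)
    obtain ⟨E, hE, h⟩ := (hac.sub_constant v).neg.exists_le_mul_of_linear
      (p := fun s => -dslope (quadResistance b k) v (x s)) ht.1
      ((hds v).comp_continuousOn hxc).neg (by
        filter_upwards [u_mem, x_deriv] with s h1 h2 hs
        refine ⟨1 - u s, sub_nonneg.2 (h1 (hsub s hs)).2,
          ((h2 (hsub s hs)).sub_const v).neg.congr_deriv ?_⟩
        have := hsl v (x s)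
        simp only [Pi.neg_apply]
        linarith)
    simp only [Pi.neg_apply, x_init] at h
    have : 0 < -(x t - v) := pos_of_mul_pos_right (by linarith) hE.le
    have := hmono (show x t < v by linarith)
    linarith

/-! ### The switching structure of an extremal. -/

namespace IsRocketExtremal

variable {b k g T α₀ α : ℝ} {x ψ u : ℝ → ℝ}

theorem x_cont (h : IsRocketExtremal b k g T α₀ α x ψ u) : ContinuousOn x (Icc 0 T) := by
  have := h.x_ac.continuousOn; rwa [uIcc_of_le h.T_pos.le] at this

theorem ψ_cont (h : IsRocketExtremal b k g T α₀ α x ψ u) : ContinuousOn ψ (Icc 0 T) := by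
  have := h.ψ_ac.continuousOn; rwa [uIcc_of_le h.T_pos.le] at this

theorem resistance_mem (h : IsRocketExtremal b k g T α₀ α x ψ u) {t : ℝ} (ht : t ∈ Icc 0 T) :
    quadResistance b k (x t) + g ∈ Ioo (0 : ℝ) 1 :=
  quadResistance_add_mem_Ioo h.b_pos h.k_pos h.g_pos h.g_lt_one h.x_ac h.x_init h.u_mem h.x_deriv ht

theorem x_lt_of_full_thrust (h : IsRocketExtremal b k g T α₀ α x ψ u) {a c : ℝ} (ha : 0 ≤ a)
    (hac : a < c) (hc : c ≤ T) (hψ : ∀ t ∈ Ioo a c, α < ψ t) : x a < x c := by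
  refine (h.x_ac.subinterval ha hac.le hc).lt_of_ae_deriv_pos hac ?_
  filter_upwards [h.x_deriv, h.u_eq_one] with t h1 h2 ht
  have htT : t ∈ Ioo 0 T := ⟨ha.trans_lt ht.1, ht.2.trans_le hc⟩
  refine ⟨_, h1 htT, ?_⟩
  have := (h.resistance_mem (Ioo_subset_Icc_self htT)).2
  rw [h2 htT (hψ t ht)]; linarith

theorem x_lt_of_no_thrust (h : IsRocketExtremal b k g T α₀ α x ψ u) {a c : ℝ} (ha : 0 ≤ a)
    (hac : a < c) (hc : c ≤ T) (hψ : ∀ t ∈ Ioo a c, ψ t < α) : x c < x a := by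
  suffices (-x) a < (-x) c by simpa using this
  refine (h.x_ac.subinterval ha hac.le hc).neg.lt_of_ae_deriv_pos hac ?_
  filter_upwards [h.x_deriv, h.u_eq_zero] with t h1 h2 ht
  have htT : t ∈ Ioo 0 T := ⟨ha.trans_lt ht.1, ht.2.trans_le hc⟩
  refine ⟨_, (h1 htT).neg, ?_⟩
  have := (h.resistance_mem (Ioo_subset_Icc_self htT)).1
  rw [h2 htT (hψ t ht)]; linarith

theorem energy_eq (h : IsRocketExtremal b k g T α₀ α x ψ u) {t : ℝ} (ht : t ∈ Icc 0 T) :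
    α₀ * x t - ψ t * (quadResistance b k (x t) + g) + max (ψ t - α) 0 = α₀ * x T := by
  obtain ⟨C, hC⟩ := h.energy
  have hT := hC T ⟨h.T_pos.le, le_rfl⟩
  rw [hC t ht, ← hT, h.ψ_final, max_eq_right (by linarith [h.α_pos])]
  ring

/-- At time `0` the conserved energy is `-ψ(0) g + max (ψ(0) - α) 0`; since `0 < g < 1`, as a
function of `ψ(0)` it is least at `ψ(0) = α`. -/
theorem neg_mul_le_final (h : IsRocketExtremal b k g T α₀ α x ψ u) :
    -(α * g) ≤ α₀ * x T := by
  have h0 := h.energy_eq (t := 0) ⟨le_rfl, h.T_pos.le⟩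
  have h00 : quadResistance b k 0 = 0 := by simp [quadResistance]
  rw [h.x_init, h00] at h0
  have h1 := h.g_pos
  have h2 := h.g_lt_one
  rcases le_total (ψ 0) α with hle | hle
  · rw [max_eq_right (by linarith)] at h0
    nlinarith
  · rw [max_eq_left (by linarith)] at h0
    nlinarith

/-- With `ψ ≥ α` and upward velocity the costate must not be increasing: otherwise it would
increase until the final time. -/
theorem slope_le (h : IsRocketExtremal b k g T α₀ α x ψ u) {t : ℝ} (ht : t ∈ Icc 0 T)
    (hψ : α ≤ ψ t) (hx : 0 ≤ x t) : α * (b * |x t| + k) ≤ α₀ := by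
  by_contra! hlt
  have hαT : ψ T < α := by rw [h.ψ_final]; exact h.α_pos
  have htT : t < T := lt_of_le_of_ne ht.2 fun e => (e ▸ hψ).not_gt hαT
  -- `ψ - α` solves a linear equation with source `α (b |x| + k) - α₀`, so it becomes positive while
  -- this source is.
  have grow : ∀ s ∈ Ioc t T, (∀ r ∈ Ioo t s, α₀ < α * (b * |x r| + k)) → α < ψ s := by
    intro s hs hr
    obtain ⟨E, hE, h1⟩ := ((h.ψ_ac.subinterval ht.1 hs.1.le hs.2).sub_constant α
      ).exists_lt_mul_of_linear (p := fun r => b * |x r| + k) hs.1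
      (((h.x_cont.mono (Icc_subset_Icc ht.1 hs.2)).abs.const_mul b).add continuousOn_const) (by
        filter_upwards [h.ψ_deriv] with r h1 hrt
        refine ⟨α * (b * |x r| + k) - α₀, sub_pos.2 (hr r hrt),
          ((h1 ⟨ht.1.trans_lt hrt.1, hrt.2.trans_le hs.2⟩).sub_const α).congr_deriv ?_⟩
        ring)
    have : 0 < ψ s - α := pos_of_mul_pos_right (by linarith) hE.le
    linarith
  set S := Icc t T ∩ (fun r => α * (b * |x r| + k)) ⁻¹' Iic α₀ with hS
  have hcont : ContinuousOn (fun r => α * (b * |x r| + k)) (Icc t T) :=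
    ((((h.x_cont.mono (Icc_subset_Icc_left ht.1)).abs.const_mul b).add
      continuousOn_const).const_mul α)
  have hScomp : IsCompact S :=
    isCompact_Icc.of_isClosed_subset (hcont.preimage_isClosed_of_isClosed isClosed_Icc isClosed_Iic)
      inter_subset_left
  rcases S.eq_empty_or_nonempty with hemp | hne
  · refine hαT.not_gt (grow T ⟨htT, le_rfl⟩ fun r hr => ?_)
    by_contra! hle
    exact (hemp ▸ (⟨Ioo_subset_Icc_self hr, hle⟩ : r ∈ S) : r ∈ (∅ : Set ℝ))
  -- Up to the first time `s` at which the source stops being positive there is full thrust, so `x s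
  -- > x t ≥ 0` and the source has not decreased: a contradiction.
  · obtain ⟨s, ⟨hsI, hsle⟩, hsmin⟩ := hScomp.exists_isLeast hne
    have hts : t < s := lt_of_le_of_ne hsI.1 fun e => by
      rw [← e] at hsle; exact hlt.not_ge hsle
    have hbelow : ∀ r ∈ Ioo t s, α₀ < α * (b * |x r| + k) := fun r hr => by
      by_contra! hle
      exact (hsmin ⟨⟨hr.1.le, hr.2.le.trans hsI.2⟩, hle⟩).not_gt hr.2
    have hxs := h.x_lt_of_full_thrust ht.1 hts hsI.2 fun r hr =>
      grow r ⟨hr.1, hr.2.le.trans hsI.2⟩ fun q hq => hbelow q ⟨hq.1, hq.2.trans hr.2⟩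
    have hb := h.b_pos
    have hα := h.α_pos
    have : α * (b * |x t| + k) ≤ α * (b * |x s| + k) := by
      rw [abs_of_nonneg hx, abs_of_nonneg (hx.trans hxs.le)]
      gcongr
    exact absurd hsle (not_le.2 (hlt.trans_le this))

theorem switch_eq (h : IsRocketExtremal b k g T α₀ α x ψ u) {t : ℝ} (ht : t ∈ Icc 0 T)
    (hψ : ψ t = α) : α₀ * x t - α * (quadResistance b k (x t) + g) = α₀ * x T := by
  have := h.energy_eq ht
  rw [hψ] at this
  simpa using this

theorem final_lt (h : IsRocketExtremal b k g T α₀ α x ψ u) {t : ℝ} (ht : t ∈ Icc 0 T)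
    (hψ : ψ t = α) : x T < x t := by
  have h1 := h.switch_eq ht hψ
  have h2 := mul_pos h.α_pos (h.resistance_mem ht).1
  exact lt_of_mul_lt_mul_left (by linarith) h.α₀_pos.le

/-- The switching function does not vanish during a descent, by convexity of
`α₀ x - α (φ(x) + g)` on the negative half-line. -/
theorem switch_nonneg (h : IsRocketExtremal b k g T α₀ α x ψ u) {t : ℝ} (ht : t ∈ Icc 0 T)
    (hψ : ψ t = α) : 0 ≤ x t := by
  by_contra! hneg
  have hlt := h.final_lt ht hψ
  have h1 := h.switch_eq ht hψ
  have h2 := mul_pos h.α_pos (h.resistance_mem (t := T) ⟨h.T_pos.le, le_rfl⟩).1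
  have h3 := h.neg_mul_le_final
  rw [quadResistance_eq, abs_of_neg hneg] at h1
  rw [quadResistance_eq, abs_of_neg (hlt.trans hneg)] at h2
  have hb := mul_pos h.α_pos h.b_pos
  generalize x t = r at *
  generalize x T = p at *
  -- With `p < r < 0`, strict convexity of `F` on the negative half-line gives `F r < max (F p) (F
  -- 0) ≤ α₀ p`, against `F r = α₀ p`. The products are the convexity inequality with weights `-r`
  -- and `r - p`, cleared of the denominator `-p`.
  have e1 := mul_pos h2 (neg_pos.2 hneg)
  have e2 := mul_nonneg (sub_nonneg.2 h3) (sub_pos.2 hlt).le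
  have e3 := mul_pos hb (mul_pos (mul_pos (neg_pos.2 (hlt.trans hneg)) (neg_pos.2 hneg))
    (sub_pos.2 hlt))
  have e4 : (α₀ * r - α * (b / 2 * (r * -r) + k * r + g) - α₀ * p) * p = 0 := by
    rw [h1]; ring
  nlinarith

/-- If the velocities differed, the slopes of `F` at the two points would sum to zero. Both are
nonnegative, hence both vanish, and strict concavity makes the points equal. -/
theorem switch_unique (h : IsRocketExtremal b k g T α₀ α x ψ u) {t t' : ℝ} (ht : t ∈ Icc 0 T)
    (ht' : t' ∈ Icc 0 T) (hψ : ψ t = α) (hψ' : ψ t' = α) : x t = x t' := by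
  have h0 := h.switch_nonneg ht hψ
  have h0' := h.switch_nonneg ht' hψ'
  have h1 := h.slope_le ht hψ.ge h0
  have h1' := h.slope_le ht' hψ'.ge h0'
  have h2 := h.switch_eq ht hψ
  have h2' := h.switch_eq ht' hψ'
  rw [quadResistance_eq] at h2 h2'
  rw [abs_of_nonneg h0] at h1 h2
  rw [abs_of_nonneg h0'] at h1' h2'
  have hb := mul_pos h.α_pos h.b_pos
  generalize x t = r at *
  generalize x t' = q at *
  have e : (r - q) * (α₀ - α * k - α * b / 2 * (r + q)) = 0 := by linear_combination h2 - h2'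
  rcases mul_eq_zero.1 e with e | e
  · linarith
  · have : α * b * r = α * b * q := by linarith
    exact mul_left_cancel₀ hb.ne' this

/-- On a gap `ψ - α` has constant sign, so `x` would be strictly monotone between two equal values.
-/
theorem no_gap (h : IsRocketExtremal b k g T α₀ α x ψ u) {a c : ℝ} (ha : 0 ≤ a) (hac : a < c)
    (hc : c ≤ T) (hψa : ψ a = α) (hψc : ψ c = α) : ∃ t ∈ Ioo a c, ψ t = α := by
  by_contra! hne
  have hx := h.switch_unique ⟨ha, hac.le.trans hc⟩ ⟨ha.trans hac.le, hc⟩ hψa hψc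
  rcases isPreconnected_Ioo.forall_lt_or_forall_gt
    (h.ψ_cont.mono (Ioo_subset_Icc_self.trans (Icc_subset_Icc ha hc))) hne with hs | hs
  · exact (h.x_lt_of_no_thrust ha hac hc hs).ne' hx
  · exact (h.x_lt_of_full_thrust ha hac hc hs).ne hx

/-- Structure of the switching function: `ψ > α`, then `ψ = α`, then `ψ < α`. -/
theorem exists_switching_times (h : IsRocketExtremal b k g T α₀ α x ψ u) :
    ∃ t₁ t₂, 0 < t₁ ∧ t₁ ≤ t₂ ∧ t₂ < T ∧ (∀ t ∈ Ico 0 t₁, α < ψ t) ∧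
      (∀ t ∈ Icc t₁ t₂, ψ t = α) ∧ ∀ t ∈ Ioc t₂ T, ψ t < α := by
  have hαT : ψ T < α := by rw [h.ψ_final]; exact h.α_pos
  set Z := Icc 0 T ∩ ψ ⁻¹' {α} with hZ
  have hZcomp : IsCompact Z := isCompact_Icc.of_isClosed_subset
    (h.ψ_cont.preimage_isClosed_of_isClosed isClosed_Icc isClosed_singleton) inter_subset_left
  have hTI : T ∈ Icc 0 T := ⟨h.T_pos.le, le_rfl⟩
  have hZne : Z.Nonempty := by
    by_contra! hemp
    have hne : ∀ t ∈ Icc 0 T, ψ t ≠ α := fun t ht e =>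
      (hemp ▸ (⟨ht, e⟩ : t ∈ Z) : t ∈ (∅ : Set ℝ))
    rcases isPreconnected_Icc.forall_lt_or_forall_gt h.ψ_cont hne with hs | hs
    · refine h.u_ne_zero ?_
      filter_upwards [h.u_eq_zero] with t h1 ht using h1 ht (hs t (Ioo_subset_Icc_self ht))
    · exact (hs T hTI).not_gt hαT
  obtain ⟨t₁, ⟨ht₁, hψ₁⟩, hmin⟩ := hZcomp.exists_isLeast hZne
  obtain ⟨t₂, ⟨ht₂, hψ₂⟩, hmax⟩ := hZcomp.exists_isGreatest hZne
  have hψ₁ : ψ t₁ = α := hψ₁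
  have hψ₂ : ψ t₂ = α := hψ₂
  have h12 : t₁ ≤ t₂ := hmin ⟨ht₂, hψ₂⟩
  have h2T : t₂ < T := lt_of_le_of_ne ht₂.2 fun e => by rw [e] at hψ₂; exact hαT.ne hψ₂
  have hmid : ∀ t ∈ Icc t₁ t₂, ψ t = α := by
    intro t ht
    by_contra hne
    obtain ⟨a, ha, c, hc, hat, htc, hgap⟩ := hZcomp.exists_gap (t := t)
      (⟨ht₁, hψ₁⟩ : t₁ ∈ Z) (⟨ht₂, hψ₂⟩ : t₂ ∈ Z) ht.1 ht.2 fun hz => hne hz.2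
    obtain ⟨r, hr, hrψ⟩ := h.no_gap ha.1.1 (hat.trans htc) hc.1.2 ha.2 hc.2
    exact hgap r hr ⟨⟨ha.1.1.trans hr.1.le, hr.2.le.trans hc.1.2⟩, hrψ⟩
  have hlast : ∀ t ∈ Ioc t₂ T, ψ t < α := by
    have hsub : Ioc t₂ T ⊆ Icc 0 T := fun t ht => ⟨ht₁.1.trans (h12.trans ht.1.le), ht.2⟩
    rcases isPreconnected_Ioc.forall_lt_or_forall_gt (h.ψ_cont.mono hsub) (v := α)
      (fun t ht e => (hmax ⟨hsub ht, e⟩).not_gt ht.1) with hs | hs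
    · exact hs
    · exact absurd (hs T ⟨h2T, le_rfl⟩) hαT.not_gt
  have h1pos : 0 < t₁ := by
    refine lt_of_le_of_ne ht₁.1 fun e => ?_
    subst e
    rcases h12.eq_or_lt with e | hlt
    · subst e
      refine h.u_ne_zero ?_
      filter_upwards [h.u_eq_zero] with t h1 ht using h1 ht (hlast t (Ioo_subset_Ioc_self ht))
    -- A singular arc starting at time `0` keeps `x = 0`, so `ψ' = 0` forces `α₀ = α k`. The energy
    -- then gives `k x(T) = -g`, whence `φ(x(T)) + g < 0`, which the velocity bounds exclude.
    · obtain ⟨t, ht, hd⟩ := exists_mem_Ioo_of_ae hlt h.ψ_deriv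
      have hx0 : x t = 0 := (h.switch_unique ⟨ht.1.le, (ht.2.trans h2T).le⟩ ht₁
        (hmid t (Ioo_subset_Icc_self ht)) hψ₁).trans h.x_init
      have hconst : HasDerivAt ψ 0 t := (hasDerivAt_const t α).congr_of_eventuallyEq <| by
        filter_upwards [Ioo_mem_nhds ht.1 ht.2] with s hs using hmid s (Ioo_subset_Icc_self hs)
      have h3 := (hd ⟨ht.1, ht.2.trans h2T⟩).unique hconst
      rw [hx0, hmid t (Ioo_subset_Icc_self ht), abs_zero] at h3
      have h4 := h.switch_eq ht₁ hψ₁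
      have h5 := h.final_lt ht₁ hψ₁
      have h6 := mul_pos h.α_pos (h.resistance_mem hTI).1
      rw [h.x_init] at h4 h5
      rw [quadResistance_eq, abs_of_neg h5] at h6
      rw [quadResistance_eq, abs_zero] at h4
      have h7 := mul_pos (mul_pos h.α_pos h.b_pos) (mul_pos_of_neg_of_neg h5 h5)
      have h8 : α₀ = α * k := by linarith
      rw [h8] at h4
      nlinarith
  have hfirst : ∀ t ∈ Ico 0 t₁, α < ψ t := by
    have hsub : Ico 0 t₁ ⊆ Icc 0 T := fun t ht => ⟨ht.1, ht.2.le.trans ht₁.2⟩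
    rcases isPreconnected_Ico.forall_lt_or_forall_gt (h.ψ_cont.mono hsub) (v := α)
      (fun t ht e => (hmin ⟨hsub ht, e⟩).not_gt ht.2) with hs | hs
    · have h3 := h.x_lt_of_no_thrust le_rfl h1pos ht₁.2 fun t ht => hs t (Ioo_subset_Ico_self ht)
      rw [h.x_init] at h3
      exact absurd (h.switch_nonneg ht₁ hψ₁) h3.not_ge
    · exact hs
  exact ⟨t₁, t₂, h1pos, h12, h2T, hfirst, hmid, hlast⟩

/-- The control of an extremal: full thrust, then possibly the singular arc, then no thrust. -/
theorem exists_control_times (h : IsRocketExtremal b k g T α₀ α x ψ u) :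
    ∃ t₁ t₂, 0 < t₁ ∧ t₁ ≤ t₂ ∧ t₂ < T ∧ (∀ᵐ t, t ∈ Ioo 0 t₁ → u t = 1) ∧
      (∀ᵐ t, t ∈ Ioo t₁ t₂ → u t = quadResistance b k (x t) + g) ∧
      ∀ᵐ t, t ∈ Ioo t₂ T → u t = 0 := by
  obtain ⟨t₁, t₂, h1, h12, h2, hfirst, hmid, hlast⟩ := h.exists_switching_times
  refine ⟨t₁, t₂, h1, h12, h2, ?_, ?_, ?_⟩
  · filter_upwards [h.u_eq_one] with t hu ht
    exact hu ⟨ht.1, ht.2.trans (h12.trans_lt h2)⟩ (hfirst t (Ioo_subset_Ico_self ht))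
  · filter_upwards [h.x_deriv] with t hd ht
    have hmem : ∀ s ∈ Ioo t₁ t₂, s ∈ Ioo 0 T := fun s hs => ⟨h1.trans hs.1, hs.2.trans h2⟩
    have hconst : HasDerivAt x 0 t := (hasDerivAt_const t (x t)).congr_of_eventuallyEq <| by
      filter_upwards [Ioo_mem_nhds ht.1 ht.2] with s hs
      exact h.switch_unique (Ioo_subset_Icc_self (hmem s hs)) (Ioo_subset_Icc_self (hmem t ht))
        (hmid s (Ioo_subset_Icc_self hs)) (hmid t (Ioo_subset_Icc_self ht))
    have := (hd (hmem t ht)).unique hconst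
    linarith
  · filter_upwards [h.u_eq_zero] with t hu ht
    exact hu ⟨(h1.trans_le h12).trans ht.1, ht.2⟩ (hlast t (Ioo_subset_Ioc_self ht))

end IsRocketExtremal

/-! ### From the maximum principle to extremals. -/

namespace RocketProblem

variable {b k g T m₀ mT : ℝ} {P : RocketProblem} {w : RocketProcess}

theorem ae_Ioo_of_ae_restrict_Icc {p : ℝ → Prop} {a c : ℝ}
    (h : ∀ᵐ t ∂volume.restrict (Icc a c), p t) : ∀ᵐ t, t ∈ Ioo a c → p t := by
  rw [ae_restrict_iff' measurableSet_Icc] at h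
  filter_upwards [h] with t ht hm using ht (Ioo_subset_Icc_self hm)

theorem controlOn_iff {a c : ℝ} {v : ℝ → ℝ} :
    ControlOn w a c v ↔ ∀ᵐ t, t ∈ Ioo a c → w.u t = v t :=
  ae_restrict_iff' measurableSet_Ioo

/-- The mass decreases at a constant rate while the control is constant. -/
theorem IsAdmissible.mass_final (h : P.IsAdmissible w) {v : ℝ} (hT : 0 ≤ P.T)
    (hu : ∀ᵐ t, t ∈ Ioo 0 P.T → w.u t = v) : w.m P.T = P.m₀ - v * P.T := by
  have hac : AbsolutelyContinuousOnInterval (fun t => w.m t + v * t) 0 P.T :=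
    h.m_ac.fun_add (ContDiffOn.absolutelyContinuousOnInterval (by fun_prop))
  have hd : ∀ᵐ t, t ∈ Ioo 0 P.T → HasDerivAt (fun t => w.m t + v * t) 0 t := by
    filter_upwards [ae_Ioo_of_ae_restrict_Icc h.m_deriv, hu] with t h1 h2 ht
    refine ((h1 ht).fun_add ((hasDerivAt_id' t).const_mul v)).congr_deriv ?_
    rw [h2 ht]; ring
  have h1 := hac.le_of_ae_deriv_nonneg hT (hd.mono fun t ht hm => ⟨0, ht hm, le_rfl⟩)
  have h2 := hac.fun_neg.le_of_ae_deriv_nonneg hT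
    (hd.mono fun t ht hm => ⟨0, by simpa using (ht hm).fun_neg, le_rfl⟩)
  simp only [mul_zero, add_zero, h.m_init] at h1 h2
  linarith

/-- A Lipschitz function with vanishing derivative is constant. -/
theorem eq_final_of_lipschitz {f : ℝ → ℝ} {T : ℝ} (hf : ∃ K, LipschitzOnWith K f (Icc 0 T))
    (hd : ∀ᵐ t ∂volume.restrict (Icc 0 T), HasDerivAt f 0 t) {t : ℝ} (ht : t ∈ Icc 0 T) :
    f t = f T := by
  obtain ⟨K, hK⟩ := hf
  have hT : 0 ≤ T := ht.1.trans ht.2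
  rw [ae_restrict_iff' measurableSet_Icc] at hd
  rw [← uIcc_of_le hT] at hK hd ht
  obtain ⟨C, hC⟩ := hK.absolutelyContinuousOnInterval.const_of_ae_hasDerivAt_zero hd
  rw [hC t ht, hC T right_mem_uIcc]

/-- Along every process that satisfies the maximum principle, velocity, costate and control form
a nontrivial extremal. -/
theorem IsMultiplier.exists_isRocketExtremal (hb : 0 < b) (hk : 0 < k) (hg₀ : 0 < g) (hg₁ : g < 1)
    (hm : mT < m₀) (hT : m₀ - mT < T)
    (hw : (⟨quadResistance b k, g, T, m₀, mT⟩ : RocketProblem).IsAdmissible w)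
    {α₀ α βs βx βm : ℝ} {ψs ψx ψm : ℝ → ℝ}
    (h : (⟨quadResistance b k, g, T, m₀, mT⟩ : RocketProblem).IsMultiplier w
      α₀ α βs βx βm ψs ψx ψm) :
    IsRocketExtremal b k g T α₀ α w.x ψx w.u := by
  have hT0 : 0 < T := by linarith
  have hψs : ∀ t ∈ Icc 0 T, ψs t = α₀ := fun t ht =>
    (eq_final_of_lipschitz h.ψs_lipschitz h.adjoint_s ht).trans h.transversality_s.2
  have hψm : ∀ t ∈ Icc 0 T, ψm t = α := fun t ht =>
    (eq_final_of_lipschitz h.ψm_lipschitz h.adjoint_m ht).trans h.transversality_m.2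
  have hψT : ψx T = 0 := h.transversality_x.2
  have ψ_ac : AbsolutelyContinuousOnInterval ψx 0 T := by
    obtain ⟨K, hK⟩ := h.ψx_lipschitz
    exact LipschitzOnWith.absolutelyContinuousOnInterval (K := K)
      (by rw [uIcc_of_le hT0.le]; exact hK)
  have x_cont : ContinuousOn w.x (Icc 0 T) := by
    have := hw.x_ac.continuousOn; rwa [uIcc_of_le hT0.le] at this
  have ψ_cont : ContinuousOn ψx (Icc 0 T) := by
    have := ψ_ac.continuousOn; rwa [uIcc_of_le hT0.le] at this
  have φ_cont : ContinuousOn (fun t => quadResistance b k (w.x t)) (Icc 0 T) :=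
    (continuous_quadResistance b k).comp_continuousOn x_cont
  have ψ_deriv : ∀ᵐ t, t ∈ Ioo 0 T →
      HasDerivAt ψx (-(α₀ - ψx t * (b * |w.x t| + k))) t := by
    filter_upwards [ae_Ioo_of_ae_restrict_Icc h.adjoint_x] with t ht hmem
    have := ht hmem
    rwa [hψs t (Ioo_subset_Icc_self hmem), (hasDerivAt_quadResistance b k _).deriv] at this
  have max_cond : ∀ᵐ t, t ∈ Ioo 0 T → ∀ v ∈ Icc (0 : ℝ) 1,
      (ψx t - α) * v ≤ (ψx t - α) * w.u t := by
    filter_upwards [ae_Ioo_of_ae_restrict_Icc h.maximality] with t ht hmem v hv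
    have := ht hmem v hv
    simp only [pontryaginFunction, hψm t (Ioo_subset_Icc_self hmem)] at this
    linarith
  have u_mem := ae_Ioo_of_ae_restrict_Icc hw.u_mem
  have u_eq_one : ∀ᵐ t, t ∈ Ioo 0 T → α < ψx t → w.u t = 1 := by
    filter_upwards [max_cond, u_mem] with t h1 h2 hmem hlt
    have := le_of_mul_le_mul_left (h1 hmem 1 (by simp)) (sub_pos.2 hlt)
    exact le_antisymm (h2 hmem).2 this
  have u_eq_zero : ∀ᵐ t, t ∈ Ioo 0 T → ψx t < α → w.u t = 0 := by
    filter_upwards [max_cond, u_mem] with t h1 h2 hmem hlt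
    have := (mul_le_mul_left_of_neg (sub_neg.2 hlt)).1 (h1 hmem 0 (by simp))
    exact le_antisymm this (h2 hmem).1
  have p_cont : ∀ t ∈ Icc 0 T, ContinuousOn (fun r => b * |w.x r| + k) (Icc t T) := fun t ht =>
    ((x_cont.mono (Icc_subset_Icc_left ht.1)).abs.const_mul b).add continuousOn_const
  have slack : α ≠ 0 → w.m T = mT := fun hα => by
    have := (mul_eq_zero.1 h.slackness).resolve_left hα
    exact sub_eq_zero.1 this
  have α₀_pos : 0 < α₀ := by
    refine lt_of_le_of_ne h.nonneg.1 fun e => ?_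
    -- With `α₀ = 0` the adjoint equation is homogeneous, and `ψx T = 0` propagates backwards.
    have hψ0 : ∀ t ∈ Icc 0 T, ψx t = 0 := by
      intro t ht
      have hac := ψ_ac.subinterval ht.1 ht.2 le_rfl
      obtain ⟨E, -, h1⟩ := hac.exists_le_mul_of_linear ht.2 (p_cont t ht) (by
        filter_upwards [ψ_deriv] with r hr hrm
        refine ⟨0, le_rfl, (hr ⟨ht.1.trans_lt hrm.1, hrm.2⟩).congr_deriv ?_⟩
        rw [← e]; ring)
      obtain ⟨F, -, h2⟩ := hac.fun_neg.exists_le_mul_of_linear ht.2 (p_cont t ht) (by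
        filter_upwards [ψ_deriv] with r hr hrm
        refine ⟨0, le_rfl, (hr ⟨ht.1.trans_lt hrm.1, hrm.2⟩).fun_neg.congr_deriv ?_⟩
        rw [← e]; ring)
      rw [hψT] at h1 h2
      linarith
    have hz : (0 : ℝ) ∈ Icc 0 T := ⟨le_rfl, hT0.le⟩
    have hα : α ≠ 0 := fun hα => by
      refine h.nontrivial ?_
      rw [← h.transversality_s.1, ← h.transversality_x.1, ← h.transversality_m.1, hψs 0 hz,
        hψ0 0 hz, hψm 0 hz, ← e, hα]
    have hαpos : 0 < α := lt_of_le_of_ne h.nonneg.2 hα.symm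
    have := hw.mass_final (v := 0) hT0.le (by
      filter_upwards [u_eq_zero] with t hu ht
      exact hu ht (by rw [hψ0 t (Ioo_subset_Icc_self ht)]; exact hαpos))
    simp only [slack hα, zero_mul, sub_zero] at this
    exact hm.ne this
  have ψ_pos : ∀ t ∈ Ico 0 T, 0 < ψx t := by
    intro t ht
    have hac := ψ_ac.subinterval ht.1 ht.2.le le_rfl
    obtain ⟨E, -, h1⟩ := hac.fun_neg.exists_lt_mul_of_linear ht.2
      (p_cont t (Ico_subset_Icc_self ht)) (by
        filter_upwards [ψ_deriv] with r hr hrm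
        refine ⟨α₀, α₀_pos, (hr ⟨ht.1.trans_lt hrm.1, hrm.2⟩).fun_neg.congr_deriv ?_⟩
        ring)
    rw [hψT] at h1
    linarith
  have α_pos : 0 < α := by
    refine lt_of_le_of_ne h.nonneg.2 fun e => ?_
    have h1 := hw.mass_final (v := 1) hT0.le (by
      filter_upwards [u_eq_one] with t hu ht
      exact hu ht (by rw [← e]; exact ψ_pos t (Ioo_subset_Ico_self ht)))
    have h2 := hw.m_final
    simp only at h1 h2
    linarith
  refine ⟨hb, hk, hg₀, hg₁, hT0, α₀_pos, α_pos, hw.x_ac, ψ_ac, hw.x_init, hψT, u_mem,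
    ae_Ioo_of_ae_restrict_Icc hw.x_deriv, ψ_deriv, u_eq_one, u_eq_zero, ?_, fun hu => ?_⟩
  -- Writing `(ψ - α) u` as `max (ψ - α) 0` removes the control, whatever its value where `ψ = α`.
  -- What remains is continuous, so it is constant everywhere and not only almost everywhere.
  · obtain ⟨C, hC⟩ := h.energy
    refine ⟨C, Measure.eqOn_Icc_of_ae_eq volume hT0.ne (g := fun _ => C) ?_ ?_ continuousOn_const⟩
    · refine ae_restrict_of_ae_eq_of_ae_restrict Ioo_ae_eq_Icc ?_
      rw [ae_restrict_iff' measurableSet_Ioo]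
      filter_upwards [ae_Ioo_of_ae_restrict_Icc hC, u_eq_one, u_eq_zero] with t h1 h2 h3 ht
      have h4 := h1 ht
      have htI := Ioo_subset_Icc_self ht
      simp only [pontryaginFunction, hψs t htI, hψm t htI] at h4
      rcases lt_trichotomy (ψx t) α with hlt | heq | hgt
      · rw [h3 ht hlt] at h4
        rw [max_eq_right (by linarith)]; linarith
      · rw [heq] at h4 ⊢
        rw [max_eq_right (by linarith)]; linarith
      · rw [h2 ht hgt] at h4
        rw [max_eq_left (by linarith)]; linarith
    · exact ((x_cont.const_mul α₀).sub (ψ_cont.mul (φ_cont.add continuousOn_const))).add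
        ((ψ_cont.sub continuousOn_const).sup continuousOn_const)
  · have := hw.mass_final (v := 0) hT0.le hu
    simp only [slack α_pos.ne', zero_mul, sub_zero] at this
    exact hm.ne this

/-- Two incompatible descriptions of the control cannot hold on overlapping intervals. -/
theorem le_of_controls_disagree {u v v' : ℝ → ℝ} {a c a' c' : ℝ} (hac : a < c) (ha'c' : a' < c')
    (h : ∀ᵐ t, t ∈ Ioo a c → u t = v t) (h' : ∀ᵐ t, t ∈ Ioo a' c' → u t = v' t)
    (hne : ∀ t ∈ Ioo a c ∩ Ioo a' c', v t ≠ v' t) : c ≤ a' ∨ c' ≤ a := by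
  by_contra! hlt
  obtain ⟨t, ht, h1, h2⟩ := exists_mem_Ioo_of_ae
    (max_lt (lt_min hac hlt.2) (lt_min hlt.1 ha'c') : max a a' < min c c') (h.and h')
  have htI : t ∈ Ioo a c ∩ Ioo a' c' := by rwa [Ioo_inter_Ioo]
  exact hne t htI ((h1 htI.1).symm.trans (h2 htI.2))

end RocketProblem

/-! ### The classification. -/

theorem theorem6p1 (b k g T m₀ mT : ℝ) (hb : 0 < b) (hk : 0 < k) (hg₀ : 0 < g) (hg₁ : g < 1)
    (hmT : 0 < mT) (hm : mT < m₀) (hT : m₀ - mT < T) (P : RocketProblem)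
    (hP : P = ⟨quadResistance b k, g, T, m₀, mT⟩) :
    (∀ w : RocketProcess, P.IsAdmissible w → P.IsTypeIII w → ¬ P.SatisfiesMP w) ∧
    (∀ w : RocketProcess, P.IsAdmissible w → P.SatisfiesMP w →
      P.IsTypeIa w ∨ P.IsTypeIb w ∨ P.IsTypeIIa w ∨ P.IsTypeIIb w) := by
  subst hP
  constructor
  · rintro w hw ⟨s₁, s₂, s₃, h01, h12, h23, h3T, hc1, hc2, hc3, hc4⟩ ⟨_, _, _, _, _, _, _, _, hmul⟩
    have hex := hmul.exists_isRocketExtremal hb hk hg₀ hg₁ hm hT hw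
    obtain ⟨t₁, t₂, h1, h12', h2, hu1, hu2, hu3⟩ := hex.exists_control_times
    rw [RocketProblem.controlOn_iff] at hc2 hc3
    have hle1 : t₁ ≤ s₁ :=
      (RocketProblem.le_of_controls_disagree h1 h12 hu1 hc2 fun _ _ => one_ne_zero).resolve_right
        (by linarith)
    -- The first coasting arc of type III cannot meet the singular arc, where `u = φ(x) + g > 0`. It
    -- therefore starts after `t₂`, when the engine stays off, which excludes the second burn.
    have hle2 : t₂ ≤ s₁ := by
      rcases h12'.eq_or_lt with e | hlt
      · exact e ▸ hle1
      · refine (RocketProblem.le_of_controls_disagree hlt h12 hu2 hc2 fun t ht => ?_).resolve_right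
          (by linarith)
        exact (hex.resistance_mem ⟨(h1.trans ht.1.1).le, (ht.1.2.trans h2).le⟩).1.ne'
    have := RocketProblem.le_of_controls_disagree h2 h23 hu3 hc3 fun _ _ => zero_ne_one
    simp only at h3T
    rcases this with h | h <;> linarith
  · rintro w hw ⟨_, _, _, _, _, _, _, _, hmul⟩
    have hex := hmul.exists_isRocketExtremal hb hk hg₀ hg₁ hm hT hw
    obtain ⟨t₁, t₂, h1, h12, h2, hu1, hu2, hu3⟩ := hex.exists_control_times
    -- A degenerate singular arc gives Ia, a genuine one Ib.
    rcases h12.eq_or_lt with rfl | hlt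
    · exact Or.inl ⟨t₁, h1, h2, RocketProblem.controlOn_iff.2 hu1, RocketProblem.controlOn_iff.2 hu3⟩
    · exact Or.inr (Or.inl ⟨t₁, t₂, h1, hlt, h2, RocketProblem.controlOn_iff.2 hu1, RocketProblem.controlOn_iff.2 hu2,
        RocketProblem.controlOn_iff.2 hu3⟩)
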